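/- **Setting.** Let $L\ge 1$ sensors be numbered $1,\dots,L$, let $\rho_{0,1}=\rho$, $\rho_{\ell-1,\ell}\in(0,1)$ for $1\le \ell\le L$, and put $\rho_{L,L+1}=0$. The change-points $\Gamma_1\le\dots\le\Gamma_L$ form a Markov chain across the sensors: $P(\Gamma_1=m)=\rho(1-\rho)^m$ and $P(\Gamma_\ell=m_1+m_2\mid\Gamma_{\ell-1}=m_2)=\rho_{\ell-1,\ell}(1-\rho_{\ell-1,\ell})^{m_1}$ for $m,m_1,m_2\ge0$, $2\le\ell\le L$. Given the change-points, the observations $Z_{k,\ell}$ ($k\ge1$, $1\le\ell\le L$) are independent, with probability density $f_0$ if $k<\Gamma_\ell$ and $f_1$ if $k\ge\Gamma_\ell$ (densities with respect to a common $\sigma$-finite reference measure $dx$). Assume $f_0=0$ a.e. where $f_1=0$, and that $D=D(f_1,f_0)=\int\log\big(f_1(x)/f_0(x)\big)f_1(x)\,dx$ is finite (in particular $f_1=0$ a.e. where $f_0=0$). Let $L_{k,j}=f_1(Z_{k,j})/f_0(Z_{k,j})$, let $I_k$ be the information in $\{Z_{m,j}:1\le m\le k,\ 1\le j\le L\}$,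 and for $1\le\ell\le L+1$ let $$p_{k,\ell}=P\big(\Gamma_1\le k,\dots,\Gamma_{\ell-1}\le k,\ \Gamma_\ell>k,\dots,\Gamma_L>k\,\big|\,I_k\big),\qquad q_{k,\ell}=\frac{p_{k,\ell}}{\rho\,p_{k,1}},\qquad \nu_A=\inf\Big\{k:\log\sum_{\ell=2}^{L+1}q_{k,\ell}\ge A\Big\}.$$ Put $w_m^\ell=\prod_{j=m-1}^{\ell-2}\rho_{j,j+1}$ (empty products are $1$), $B_{m,n,\ell}=\sum_{p=n-1}^{\ell-1}(1-\rho_{p,p+1})\prod_{j=1}^pL_{m,j}$, $C_{m,n,\ell}=B_{m,n,\ell}-(1-\rho_{\ell-1,\ell})\prod_{j=1}^{\ell-1}L_{m,j}$, $$\zeta_{m,\ell}=\frac{1}{(1-\rho_{\ell-1,\ell})\prod_{j=1}^{\ell-1}L_{m+1,j}}\cdot\frac{\sum_{j=1}^{\ell-1}q_{m,j}w_j^\ell C_{m+1,j,\ell}}{\sum_{j=1}^{\ell}q_{m,j}w_j^\ell},\qquad \alpha_{k,\ell}=\Big(\frac{1-\rho_{\ell-1,\ell}}{1-\rho}\Big)^k\prod_{j=1}^{\ell-2}\rho_{j,j+1}\sum_{j=0}^{\ell-1}\frac{1-\rho_{j,j+1}}{1-\rho},$$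 and, at time $k\ge 1$, with $J_\ell=\prod_{m=0}^{k-2}(1+\zeta_{m,\ell})$, $$x_\ell=\frac{\alpha_{k,\ell+1}}{\alpha_{k,\ell}}\Big(\prod_{m=1}^kL_{m,\ell}\Big)\frac{J_{\ell+1}}{J_\ell}\quad(2\le\ell\le L),\qquad \eta_2=1,\quad \eta_{\ell+1}=\frac{\eta_\ell x_\ell}{1+\eta_\ell x_\ell}\quad(2\le\ell\le L-1).$$ **Proposition.** Suppose that for all $2\le\ell\le j\le L$ the limit $$\gamma_{\ell,j}=\lim_{k\to\infty}\frac1k\sum_{m=1}^k\log\Big(\frac{1+\zeta_{m,j+1}}{1+\zeta_{m,\ell}}\Big)$$ exists almost surely and is finite (it is allowed to depend on the realization). Let $$\Delta_{\ell,j}=\log\Big(\frac{1-\rho_{j,j+1}}{1-\rho_{\ell-1,\ell}}\Big)+(j-\ell+1)D+\gamma_{\ell,j},$$ and let $\ell^\star$ be the smallest $\ell\in\{2,\dots,L\}$ with $\Delta_{\ell,j}\le0$ for all $j=\ell,\dots,L$, and $\ell^\star=L+1$ if there is no such $\ell$. Then almost surely $\nu_A$ is finite for every $A\in\mathbb R$,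 $\nu_A\to\infty$ as $A\to\infty$, and $$\frac1k\sum_{\ell=2}^L\log(1+\eta_\ell x_\ell)-\frac1k\sum_{\ell=2}^{\ell^\star-1}\log x_\ell\ \longrightarrow\ 0$$ both along $k=\nu_A$ as $A\to\infty$ and as $k\to\infty$ through the integers; the second sum is $0$ if $\ell^\star=2$. -/

import Mathlib

open MeasureTheory ProbabilityTheory Filter Topology

noncomputable section

namespace ChangeProcess

/-! Conventions.  Sensors are numbered `1, …, L` and time is `ℕ`; observations are taken at the times
`1, 2, …`.  `ρ ℓ` is the geometric parameter `ρ_{ℓ, ℓ+1}` of the propagation delay from sensor `ℓ`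
to sensor `ℓ + 1`, where `ρ 0 = ρ_{0,1}` is the parameter of the disruption time `Γ 1`, and
`ρ L = ρ_{L, L+1} = 0`. -/

/-- `f` is a probability density with respect to the reference measure `ref`. -/
structure IsDensity {E : Type*} [MeasurableSpace E] (ref : Measure E) (f : E → ℝ) : Prop where
  measurable : Measurable f
  nonneg : ∀ x, 0 ≤ f x
  lintegral_eq_one : ∫⁻ x, ENNReal.ofReal (f x) ∂ref = 1

/-- The Kullback-Leibler divergence `D(f₁, f₀) = ∫ log (f₁ / f₀) f₁`. -/
def klD {E : Type*} [MeasurableSpace E] (ref : Measure E) (f₁ f₀ : E → ℝ) : ℝ :=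
  ∫ x, Real.log (f₁ x / f₀ x) * f₁ x ∂ref

/-- Finiteness of `D(f₁, f₀)`: `f₁` is absolutely continuous with respect to `f₀` and the defining
integral converges. -/
structure FiniteKL {E : Type*} [MeasurableSpace E] (ref : Measure E) (f₁ f₀ : E → ℝ) : Prop where
  absCont : ∀ᵐ x ∂ref, f₀ x = 0 → f₁ x = 0
  integrable : Integrable (fun x => Real.log (f₁ x / f₀ x) * f₁ x) ref

/-- Probability that a change at time `a` reaches the next sensor at time `b`, when the delay `b - a`
is geometric on `{0, 1, …}` with parameter `p`. -/
def geomTrans (p : ℝ) (a b : ℕ) : ℝ :=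
  if a ≤ b then p * (1 - p) ^ (b - a) else 0

/-- The event that the change-points are `Γ_ℓ = g ℓ`, `ℓ = 1, …, L`. -/
def changeEvent {Ω : Type*} (L : ℕ) (Γ : ℕ → Ω → ℕ) (g : ℕ → ℕ) : Set Ω :=
  {ω | ∀ ℓ ∈ Finset.Icc 1 L, Γ ℓ ω = g ℓ}

/-- The joint-geometric change process `Γ_1 ≤ … ≤ Γ_L` with its observations: `Γ_1` is geometric
with parameter `ρ_{0,1}`, the change-points form a Markov chain across the sensors with geometric
increments, and conditionally on the change-points all observations `Z_{k,ℓ}`, `k ≥ 1`,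
`1 ≤ ℓ ≤ L`, are independent, with density `f₀` if `k < Γ_ℓ` and `f₁` if `k ≥ Γ_ℓ`. -/
structure IsModel {E : Type*} [MeasurableSpace E] {Ω : Type*} [MeasurableSpace Ω]
    (L : ℕ) (ρ : ℕ → ℝ) (ref : Measure E) (f₀ f₁ : E → ℝ) (P : Measure Ω)
    (Γ : ℕ → Ω → ℕ) (Z : ℕ → ℕ → Ω → E) : Prop where
  measurable_change : ∀ ℓ, Measurable (Γ ℓ)
  measurable_obs : ∀ k ℓ, Measurable (Z k ℓ)
  change_law : ∀ g : ℕ → ℕ, g 0 = 0 →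
    P (changeEvent L Γ g) =
      ENNReal.ofReal (∏ ℓ ∈ Finset.Icc 1 L, geomTrans (ρ (ℓ - 1)) (g (ℓ - 1)) (g ℓ))
  obs_indep : ∀ g : ℕ → ℕ, P (changeEvent L Γ g) ≠ 0 →
    iIndepFun (fun i : ℕ × Fin L => Z (i.1 + 1) ((i.2 : ℕ) + 1)) P[|changeEvent L Γ g]
  obs_law : ∀ g : ℕ → ℕ, P (changeEvent L Γ g) ≠ 0 →
    ∀ k, 1 ≤ k → ∀ ℓ ∈ Finset.Icc 1 L,
      Measure.map (Z k ℓ) P[|changeEvent L Γ g] =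
        ref.withDensity (fun x => ENNReal.ofReal (if k < g ℓ then f₀ x else f₁ x))

/-- The information `I_k`: the σ-algebra generated by `Z_{m,ℓ}`, `1 ≤ m ≤ k`, `1 ≤ ℓ ≤ L`. -/
abbrev info {E : Type*} [MeasurableSpace E] {Ω : Type*} (L : ℕ) (Z : ℕ → ℕ → Ω → E) (k : ℕ) :
    MeasurableSpace Ω :=
  MeasurableSpace.comap
    (fun (ω : Ω) (i : Fin k × Fin L) => Z ((i.1 : ℕ) + 1) ((i.2 : ℕ) + 1) ω) MeasurableSpace.pi

/-- The event `{Γ_1 ≤ k, …, Γ_{ℓ-1} ≤ k, Γ_ℓ > k, …, Γ_L > k}`. -/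
def frontEvent {Ω : Type*} (L : ℕ) (Γ : ℕ → Ω → ℕ) (k ℓ : ℕ) : Set Ω :=
  {ω | (∀ j ∈ Finset.Icc 1 (ℓ - 1), Γ j ω ≤ k) ∧ (∀ j ∈ Finset.Icc ℓ L, k < Γ j ω)}

/-- The a posteriori probability `p_{k,ℓ}` of `frontEvent L Γ k ℓ` given `I_k`. -/
def post {E : Type*} [MeasurableSpace E] {Ω : Type*} [MeasurableSpace Ω]
    (L : ℕ) (P : Measure Ω) (Γ : ℕ → Ω → ℕ) (Z : ℕ → ℕ → Ω → E) (k ℓ : ℕ) : Ω → ℝ :=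
  P[(frontEvent L Γ k ℓ).indicator (fun _ => (1 : ℝ)) | info L Z k]

/-- `q_{k,ℓ} = p_{k,ℓ} / (ρ_{0,1} p_{k,1})`. -/
def qStat {E : Type*} [MeasurableSpace E] {Ω : Type*} [MeasurableSpace Ω]
    (L : ℕ) (ρ : ℕ → ℝ) (P : Measure Ω) (Γ : ℕ → Ω → ℕ) (Z : ℕ → ℕ → Ω → E)
    (ω : Ω) (k ℓ : ℕ) : ℝ :=
  post L P Γ Z k ℓ ω / (ρ 0 * post L P Γ Z k 1 ω)

/-- The likelihood ratio `L_{k,j} = f₁(Z_{k,j}) / f₀(Z_{k,j})`. -/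
def lik {E : Type*} {Ω : Type*} (f₀ f₁ : E → ℝ) (Z : ℕ → ℕ → Ω → E) (ω : Ω) (k j : ℕ) : ℝ :=
  f₁ (Z k j ω) / f₀ (Z k j ω)

/-- The times at which the threshold test with threshold `A` says "stop". -/
def stopTimes (L : ℕ) (q : ℕ → ℕ → ℝ) (A : ℝ) : Set ℕ :=
  {k | A ≤ Real.log (∑ ℓ ∈ Finset.Icc 2 (L + 1), q k ℓ)}

/-- The threshold test `ν_A`, the first time in `stopTimes L q A`
(meaningful if that set is nonempty). -/
def nu (L : ℕ) (q : ℕ → ℕ → ℝ) (A : ℝ) : ℕ := sInf (stopTimes L q A)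

/-! In what follows `Λ m j` stands for the likelihood ratio `L_{m,j}` and `q m j` for `q_{m,j}`,
along one realization. -/

/-- `w_m^ℓ = ∏_{j = m-1}^{ℓ-2} ρ_{j,j+1}`. -/
def wgt (ρ : ℕ → ℝ) (m ℓ : ℕ) : ℝ := ∏ j ∈ Finset.Ico (m - 1) (ℓ - 1), ρ j

/-- `B_{m,n,ℓ} = ∑_{p = n-1}^{ℓ-1} (1 - ρ_{p,p+1}) ∏_{j=1}^p L_{m,j}`. -/
def Bco (ρ : ℕ → ℝ) (Λ : ℕ → ℕ → ℝ) (m n ℓ : ℕ) : ℝ :=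
  ∑ p ∈ Finset.Ico (n - 1) ℓ, (1 - ρ p) * ∏ j ∈ Finset.Icc 1 p, Λ m j

/-- `C_{m,n,ℓ} = B_{m,n,ℓ} - (1 - ρ_{ℓ-1,ℓ}) ∏_{j=1}^{ℓ-1} L_{m,j}`. -/
def Cco (ρ : ℕ → ℝ) (Λ : ℕ → ℕ → ℝ) (m n ℓ : ℕ) : ℝ :=
  Bco ρ Λ m n ℓ - (1 - ρ (ℓ - 1)) * ∏ j ∈ Finset.Icc 1 (ℓ - 1), Λ m j

/-- `ζ_{m,ℓ}`. -/
def zeta (ρ : ℕ → ℝ) (Λ q : ℕ → ℕ → ℝ) (m ℓ : ℕ) : ℝ :=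
  1 / ((1 - ρ (ℓ - 1)) * ∏ j ∈ Finset.Icc 1 (ℓ - 1), Λ (m + 1) j) *
    ((∑ j ∈ Finset.Icc 1 (ℓ - 1), q m j * wgt ρ j ℓ * Cco ρ Λ (m + 1) j ℓ) /
      ∑ j ∈ Finset.Icc 1 ℓ, q m j * wgt ρ j ℓ)

/-- `α_{k,ℓ}`, for `ℓ ≥ 2`. -/
def alpha (ρ : ℕ → ℝ) (k ℓ : ℕ) : ℝ :=
  ((1 - ρ (ℓ - 1)) / (1 - ρ 0)) ^ k * (∏ j ∈ Finset.Icc 1 (ℓ - 2), ρ j) *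
    ∑ j ∈ Finset.range ℓ, (1 - ρ j) / (1 - ρ 0)

/-- `β_{k,ℓ} = α_{k,ℓ+1} / α_{k,ℓ}`. -/
def beta (ρ : ℕ → ℝ) (k ℓ : ℕ) : ℝ := alpha ρ k (ℓ + 1) / alpha ρ k ℓ

/-- `J_ℓ = ∏_{m=0}^{k-2} (1 + ζ_{m,ℓ})`, at time `k ≥ 1`. -/
def Jprod (ρ : ℕ → ℝ) (Λ q : ℕ → ℕ → ℝ) (k ℓ : ℕ) : ℝ :=
  ∏ m ∈ Finset.range (k - 1), (1 + zeta ρ Λ q m ℓ)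

/-- `x_ℓ = β_{k,ℓ} C_ℓ J_{ℓ+1} / J_ℓ` with `C_ℓ = ∏_{m=1}^k L_{m,ℓ}`, at time `k`. -/
def xStat (ρ : ℕ → ℝ) (Λ q : ℕ → ℕ → ℝ) (k ℓ : ℕ) : ℝ :=
  beta ρ k ℓ * (∏ m ∈ Finset.Icc 1 k, Λ m ℓ) * (Jprod ρ Λ q k (ℓ + 1) / Jprod ρ Λ q k ℓ)

/-- `η_ℓ` at time `k`: `η_2 = 1` and `η_{ℓ+1} = η_ℓ x_ℓ / (1 + η_ℓ x_ℓ)` for `ℓ ≥ 2`. -/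
def eta (ρ : ℕ → ℝ) (Λ q : ℕ → ℕ → ℝ) (k : ℕ) : ℕ → ℝ
  | 0 => 1
  | 1 => 1
  | 2 => 1
  | (ℓ + 3) => eta ρ Λ q k (ℓ + 2) * xStat ρ Λ q k (ℓ + 2) /
      (1 + eta ρ Λ q k (ℓ + 2) * xStat ρ Λ q k (ℓ + 2))

/-- `Δ_{ℓ,j} = log ((1 - ρ_{j,j+1}) / (1 - ρ_{ℓ-1,ℓ})) + (j - ℓ + 1) D + γ_{ℓ,j}`. -/
def Delta (ρ : ℕ → ℝ) (D : ℝ) (γ : ℕ → ℕ → ℝ) (ℓ j : ℕ) : ℝ :=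
  Real.log ((1 - ρ j) / (1 - ρ (ℓ - 1))) + ((j : ℝ) - (ℓ : ℝ) + 1) * D + γ ℓ j

/-- `ℓ⋆`: the smallest `ℓ ∈ {2, …, L}` with `Δ_{ℓ,j} ≤ 0` for all `j = ℓ, …, L`, and `L + 1` if
there is none. -/
def ellStar (L : ℕ) (Δ : ℕ → ℕ → ℝ) : ℕ :=
  sInf ({ℓ | 2 ≤ ℓ ∧ ℓ ≤ L ∧ ∀ j ∈ Finset.Icc ℓ L, Δ ℓ j ≤ 0} ∪ {L + 1})

/-- `(1/k) ∑_{ℓ=2}^L log (1 + η_ℓ x_ℓ) - (1/k) ∑_{ℓ=2}^{ℓ⋆-1} log x_ℓ` at time `k`. -/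
def slopeGap (L : ℕ) (ρ : ℕ → ℝ) (Λ q : ℕ → ℕ → ℝ) (ls k : ℕ) : ℝ :=
  1 / (k : ℝ) * ∑ ℓ ∈ Finset.Icc 2 L, Real.log (1 + eta ρ Λ q k ℓ * xStat ρ Λ q k ℓ) -
    1 / (k : ℝ) * ∑ ℓ ∈ Finset.Icc 2 (ls - 1), Real.log (xStat ρ Λ q k ℓ)

end ChangeProcess

end

namespace ChangeProcess

/-! Fix a realization and put X_j = x_2 ⋯ x_j, with X_1 = 1. The recursion for η makes the product
of the 1 + η_ℓ x_ℓ telescope to X_1 + ⋯ + X_L (`prod_one_add_eta`), so the claim compares (1/k) log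
∑ X_j with (1/k) log X_{ℓ⋆-1}. By Laplace's principle (`tendsto_log_sum`) a sum grows at the largest
rate of its terms. If s_j is the rate of X_j, then Δ_{ℓ,j} = s_j - s_{ℓ-1}, and the definition of ℓ⋆
forces ℓ⋆ - 1 to maximize s (`tendsto_slopeGap`). The rates exist (`tendsto_avg_log_xStat`) because
the α and J factors telescope over the sensors, while the log-likelihood ratios of each sensor
average to D: all but finitely many are post-change. The limit holds along all integers, so for ν_A
it suffices that ν_A is finite and tends to infinity. Finiteness holds because p_{k,1} is positive
for every k (`ae_post_one_pos`) while p_{k,1} → 0 and p_{k,L+1} → 1 along a subsequence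
(`ae_exists_post_gt`). -/

/-! ### Cesàro averages and exponential growth rates. -/

theorem tendsto_avg_of_succ {T : ℕ → ℝ} {D : ℝ}
    (h : Tendsto (fun n : ℕ => 1 / (n : ℝ) * T (n + 1)) atTop (𝓝 D)) :
    Tendsto (fun n : ℕ => 1 / (n : ℝ) * T n) atTop (𝓝 D) := by
  rw [← tendsto_add_atTop_iff_nat 1]
  have h1 : Tendsto (fun n : ℕ => (n : ℝ) / (n + 1)) atTop (𝓝 1) :=
    tendsto_natCast_div_add_atTop 1
  have h2 := h1.mul h
  rw [one_mul] at h2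
  refine h2.congr' ?_
  filter_upwards [eventually_gt_atTop 0] with n hn
  have : (n : ℝ) ≠ 0 := by positivity
  push_cast
  field_simp

theorem tendsto_avg_of_add {T : ℕ → ℝ} {D : ℝ} (N : ℕ)
    (h : Tendsto (fun n : ℕ => 1 / (n : ℝ) * T (n + N)) atTop (𝓝 D)) :
    Tendsto (fun n : ℕ => 1 / (n : ℝ) * T n) atTop (𝓝 D) := by
  induction N with
  | zero => simpa using h
  | succ N ih =>
    refine ih (tendsto_avg_of_succ (T := fun n => T (n + N)) ?_)
    refine h.congr fun n => ?_
    rw [Nat.add_right_comm, add_assoc]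

theorem tendsto_avg_const (c : ℝ) : Tendsto (fun n : ℕ => 1 / (n : ℝ) * c) atTop (𝓝 0) := by
  simpa using (tendsto_one_div_atTop_nhds_zero_nat (𝕜 := ℝ)).mul_const c

theorem tendsto_avg_add_const {T : ℕ → ℝ} {D : ℝ} (c : ℝ)
    (h : Tendsto (fun n : ℕ => 1 / (n : ℝ) * T n) atTop (𝓝 D)) :
    Tendsto (fun n : ℕ => 1 / (n : ℝ) * (T n + c)) atTop (𝓝 D) := by
  simpa [mul_add] using h.add (tendsto_avg_const c)

/-- The Cesàro limit does not depend on a finite initial segment. -/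
theorem tendsto_avg_Icc_of_shift {a : ℕ → ℝ} {D : ℝ} (N : ℕ)
    (h : Tendsto (fun n : ℕ => (∑ i ∈ Finset.range n, a (i + N + 1)) / (n : ℝ)) atTop (𝓝 D)) :
    Tendsto (fun n : ℕ => 1 / (n : ℝ) * ∑ m ∈ Finset.Icc 1 n, a m) atTop (𝓝 D) := by
  refine tendsto_avg_of_add (T := fun n => ∑ m ∈ Finset.Icc 1 n, a m) N ?_
  have key : ∀ n, ∑ m ∈ Finset.Icc 1 (n + N), a m =
      ∑ i ∈ Finset.range n, a (i + N + 1) + ∑ m ∈ Finset.Icc 1 N, a m := by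
    intro n
    induction n with
    | zero => simp
    | succ n ih =>
      rw [Nat.add_right_comm, Finset.sum_Icc_succ_top (by omega), ih, Finset.sum_range_succ]
      ring
  simp only [key]
  refine tendsto_avg_add_const _ (h.congr fun n => ?_)
  ring

/-- Bridges the index ranges: `Jprod` runs over 0, …, k - 2, the averages defining γ over 1, …, k.
-/
theorem tendsto_avg_range_pred {a : ℕ → ℝ} {D : ℝ}
    (h : Tendsto (fun n : ℕ => 1 / (n : ℝ) * ∑ m ∈ Finset.Icc 1 n, a m) atTop (𝓝 D)) :
    Tendsto (fun n : ℕ => 1 / (n : ℝ) * ∑ m ∈ Finset.range (n - 1), a m) atTop (𝓝 D) := by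
  refine tendsto_avg_of_add (T := fun n => ∑ m ∈ Finset.range (n - 1), a m) 2 ?_
  refine (tendsto_avg_add_const (a 0) h).congr fun n => ?_
  congr 1
  change _ = ∑ m ∈ Finset.range (n + 1), a m
  induction n with
  | zero => simp
  | succ n ih =>
    rw [Finset.sum_Icc_succ_top (by omega), Finset.sum_range_succ, ← ih]
    ring

/-- Laplace's principle for a finite sum: the exponential growth rate of a sum of positive
sequences is the largest of the growth rates. -/
theorem tendsto_log_sum {ι : Type*} (s : Finset ι) (X : ι → ℕ → ℝ) (r : ι → ℝ)
    (hX : ∀ j ∈ s, ∀ k, 0 < X j k)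
    (hr : ∀ j ∈ s, Tendsto (fun k : ℕ => 1 / (k : ℝ) * Real.log (X j k)) atTop (𝓝 (r j)))
    (i : ι) (hi : i ∈ s) (hmax : ∀ j ∈ s, r j ≤ r i) :
    Tendsto (fun k : ℕ => 1 / (k : ℝ) * Real.log (∑ j ∈ s, X j k)) atTop (𝓝 (r i)) := by
  have hcard : 0 < (s.card : ℝ) := by exact_mod_cast Finset.card_pos.mpr ⟨i, hi⟩
  rw [tendsto_order]
  constructor
  · intro b hb
    filter_upwards [(hr i hi).eventually_const_lt hb] with k hk
    refine hk.trans_le (mul_le_mul_of_nonneg_left ?_ (by positivity))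
    exact Real.log_le_log (hX i hi k)
      (Finset.single_le_sum (f := fun j => X j k) (fun j hj => (hX j hj k).le) hi)
  · intro b hb
    -- The gap b - c absorbs the cost (1/k) log |s| of bounding the sum by |s| times e^{kc}.
    obtain ⟨c, hc, hcb⟩ := exists_between hb
    have h1 : ∀ᶠ k : ℕ in atTop, ∀ j ∈ s, 1 / (k : ℝ) * Real.log (X j k) < c := by
      rw [Filter.eventually_all_finset]
      exact fun j hj => (hr j hj).eventually_lt_const ((hmax j hj).trans_lt hc)
    have h2 : ∀ᶠ k : ℕ in atTop, 1 / (k : ℝ) * Real.log s.card < b - c :=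
      (tendsto_avg_const _).eventually_lt_const (by linarith)
    filter_upwards [h1, h2, eventually_gt_atTop 0] with k hk1 hk2 hk0
    have hk : (0 : ℝ) < k := by exact_mod_cast hk0
    have hle : ∑ j ∈ s, X j k ≤ s.card * Real.exp (k * c) := by
      rw [← nsmul_eq_mul]
      refine Finset.sum_le_card_nsmul _ _ _ fun j hj => ?_
      rw [← Real.log_le_iff_le_exp (hX j hj k)]
      have := (hk1 j hj).le
      rw [one_div, inv_mul_le_iff₀ hk] at this
      exact this
    have hpos : 0 < ∑ j ∈ s, X j k := Finset.sum_pos (fun j hj => hX j hj k) ⟨i, hi⟩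
    have h3 : Real.log (∑ j ∈ s, X j k) ≤ Real.log s.card + k * c := by
      refine (Real.log_le_log hpos hle).trans_eq ?_
      rw [Real.log_mul hcard.ne' (Real.exp_pos _).ne', Real.log_exp]
    calc 1 / (k : ℝ) * Real.log (∑ j ∈ s, X j k)
        ≤ 1 / (k : ℝ) * (Real.log s.card + k * c) := by gcongr
      _ = 1 / (k : ℝ) * Real.log s.card + c := by field_simp
      _ < b := by linarith

/-! ### Algebra of η and x, and identification of ℓ⋆. -/

section Deterministic

variable {ρ : ℕ → ℝ} {Λ q : ℕ → ℕ → ℝ} {L : ℕ}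

/-- With S_n = X_1 + ⋯ + X_n, the ratio X_n / S_n solves the recursion. Hence 1 + η_{n+1} x_{n+1} =
S_{n+1} / S_n, which telescopes. -/
theorem eta_eq_div {k n : ℕ} (hn : 1 ≤ n) (hx : ∀ ℓ ∈ Finset.Icc 2 n, 0 < xStat ρ Λ q k ℓ) :
    eta ρ Λ q k (n + 1) = (∏ i ∈ Finset.Icc 2 n, xStat ρ Λ q k i) /
      ∑ j ∈ Finset.Icc 1 n, ∏ i ∈ Finset.Icc 2 j, xStat ρ Λ q k i := by
  induction n, hn using Nat.le_induction with
  | base => simp [eta]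
  | succ n hn ih =>
    have ih' := ih fun ℓ hℓ => hx ℓ (Finset.Icc_subset_Icc_right n.le_succ hℓ)
    have hpos : ∀ j ∈ Finset.Icc 1 n, 0 < ∏ i ∈ Finset.Icc 2 j, xStat ρ Λ q k i := fun j hj =>
      Finset.prod_pos fun i hi => hx i (by simp only [Finset.mem_Icc] at hi hj ⊢; omega)
    have hS := Finset.sum_pos hpos ⟨n, by simp [hn]⟩
    have hX := hpos n (by simp [hn])
    have hxn := hx (n + 1) (by simp; omega)
    have hstep : eta ρ Λ q k (n + 1 + 1) = eta ρ Λ q k (n + 1) * xStat ρ Λ q k (n + 1) /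
        (1 + eta ρ Λ q k (n + 1) * xStat ρ Λ q k (n + 1)) := by
      -- The recursive clause of `eta` matches on `ℓ + 3`, so the index must show three successors.
      obtain ⟨m, rfl⟩ : ∃ m, n = m + 1 := ⟨n - 1, by omega⟩
      rfl
    rw [hstep, ih', Finset.sum_Icc_succ_top (by omega), Finset.prod_Icc_succ_top (by omega)]
    field_simp

theorem prod_one_add_eta {k n : ℕ} (hn : 1 ≤ n)
    (hx : ∀ ℓ ∈ Finset.Icc 2 n, 0 < xStat ρ Λ q k ℓ) :
    ∏ ℓ ∈ Finset.Icc 2 n, (1 + eta ρ Λ q k ℓ * xStat ρ Λ q k ℓ) =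
      ∑ j ∈ Finset.Icc 1 n, ∏ i ∈ Finset.Icc 2 j, xStat ρ Λ q k i := by
  induction n, hn using Nat.le_induction with
  | base => simp
  | succ n hn ih =>
    have hx' : ∀ ℓ ∈ Finset.Icc 2 n, 0 < xStat ρ Λ q k ℓ :=
      fun ℓ hℓ => hx ℓ (Finset.Icc_subset_Icc_right n.le_succ hℓ)
    have hpos : ∀ j ∈ Finset.Icc 1 n, 0 < ∏ i ∈ Finset.Icc 2 j, xStat ρ Λ q k i := fun j hj =>
      Finset.prod_pos fun i hi => hx i (by simp only [Finset.mem_Icc] at hi hj ⊢; omega)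
    have hS := Finset.sum_pos hpos ⟨n, by simp [hn]⟩
    rw [Finset.prod_Icc_succ_top (by omega), ih hx', eta_eq_div hn hx',
      Finset.sum_Icc_succ_top (by omega),
      Finset.prod_Icc_succ_top (a := 2) (b := n) (by omega)]
    field_simp

theorem one_add_eta_pos {k n ℓ : ℕ} (hx : ∀ ℓ ∈ Finset.Icc 2 n, 0 < xStat ρ Λ q k ℓ)
    (hℓ : ℓ ∈ Finset.Icc 2 n) : 0 < 1 + eta ρ Λ q k ℓ * xStat ρ Λ q k ℓ := by
  rw [Finset.mem_Icc] at hℓ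
  obtain ⟨m, rfl⟩ : ∃ m, ℓ = m + 1 := ⟨ℓ - 1, by omega⟩
  rw [eta_eq_div (by omega) fun i hi => hx i (by simp only [Finset.mem_Icc] at hi ⊢; omega)]
  have hpos : ∀ j, j ≤ m → 0 < ∏ i ∈ Finset.Icc 2 j, xStat ρ Λ q k i := fun j hj =>
    Finset.prod_pos fun i hi => hx i (by simp only [Finset.mem_Icc] at hi ⊢; omega)
  have h1 := hx (m + 1) (Finset.mem_Icc.mpr hℓ)
  have h2 := hpos m le_rfl
  have h3 : 0 ≤ ∑ j ∈ Finset.Icc 1 m, ∏ i ∈ Finset.Icc 2 j, xStat ρ Λ q k i :=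
    Finset.sum_nonneg fun j hj => (hpos j (Finset.mem_Icc.mp hj).2).le
  exact add_pos_of_pos_of_nonneg one_pos (mul_nonneg (div_nonneg h2.le h3) h1.le)

/-- If all the partial sums of `log x_ℓ` have growth rates `Δ`, then the sum of these growth rates
up to `ℓ⋆ - 1` is the largest one. -/
theorem tendsto_slopeGap (hL : 1 ≤ L) (Δ : ℕ → ℕ → ℝ)
    (hx : ∀ k, ∀ ℓ ∈ Finset.Icc 2 L, 0 < xStat ρ Λ q k ℓ)
    (hΔ : ∀ ℓ j, 2 ≤ ℓ → ℓ ≤ j → j ≤ L → Tendsto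
      (fun k : ℕ => 1 / (k : ℝ) * ∑ i ∈ Finset.Icc ℓ j, Real.log (xStat ρ Λ q k i))
      atTop (𝓝 (Δ ℓ j))) :
    Tendsto (fun k : ℕ => slopeGap L ρ Λ q (ellStar L Δ) k) atTop (𝓝 0) := by
  -- The rate of X_j; X_1 is the empty product, of rate 0.
  set s : ℕ → ℝ := fun j => if j ≤ 1 then 0 else Δ 2 j with hs
  have hsj : ∀ j ∈ Finset.Icc 1 L, Tendsto
      (fun k : ℕ => 1 / (k : ℝ) * ∑ i ∈ Finset.Icc 2 j, Real.log (xStat ρ Λ q k i))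
      atTop (𝓝 (s j)) := by
    intro j hj
    rw [Finset.mem_Icc] at hj
    by_cases h1 : j ≤ 1
    · simp [hs, h1]
    · simp only [hs, h1, if_false]
      exact hΔ 2 j le_rfl (by omega) hj.2
  -- Additivity of Δ is not assumed; it follows from uniqueness of limits.
  have hadd : ∀ ℓ j, 2 ≤ ℓ → ℓ ≤ j → j ≤ L → Δ ℓ j = s j - s (ℓ - 1) := by
    intro ℓ j h2 hj hjL
    refine tendsto_nhds_unique (hΔ ℓ j h2 hj hjL) ?_
    refine ((hsj j (Finset.mem_Icc.mpr (by omega))).sub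
      (hsj (ℓ - 1) (Finset.mem_Icc.mpr (by omega)))).congr fun k => ?_
    have hsplit : ∑ i ∈ Finset.Icc 2 j, Real.log (xStat ρ Λ q k i) =
        ∑ i ∈ Finset.Icc 2 (ℓ - 1), Real.log (xStat ρ Λ q k i) +
          ∑ i ∈ Finset.Icc ℓ j, Real.log (xStat ρ Λ q k i) := by
      have e1 : Finset.Icc 2 j = Finset.Ico 2 (j + 1) := by
        ext; simp only [Finset.mem_Icc, Finset.mem_Ico]; omega
      have e2 : Finset.Icc 2 (ℓ - 1) = Finset.Ico 2 ℓ := by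
        ext; simp only [Finset.mem_Icc, Finset.mem_Ico]; omega
      have e3 : Finset.Icc ℓ j = Finset.Ico ℓ (j + 1) := by
        ext; simp only [Finset.mem_Icc, Finset.mem_Ico]; omega
      rw [e1, e2, e3, Finset.sum_Ico_consecutive _ h2 (by omega)]
    rw [hsplit]
    ring
  set S : Set ℕ := {ℓ | 2 ≤ ℓ ∧ ℓ ≤ L ∧ ∀ j ∈ Finset.Icc ℓ L, Δ ℓ j ≤ 0} ∪ {L + 1} with hSdef
  have hmem : ellStar L Δ ∈ S := Nat.sInf_mem ⟨L + 1, Or.inr rfl⟩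
  have hle : ∀ ℓ ∈ S, ellStar L Δ ≤ ℓ := fun ℓ hℓ => Nat.sInf_le hℓ
  have hrange : 2 ≤ ellStar L Δ ∧ ellStar L Δ ≤ L + 1 := by
    rcases hmem with h | h
    · exact ⟨h.1, h.2.1.trans (by omega)⟩
    · rw [Set.mem_singleton_iff] at h; omega
  set n := ellStar L Δ - 1 with hn
  have hnmem : n ∈ Finset.Icc 1 L := Finset.mem_Icc.mpr (by omega)
  have hright : ∀ j, n < j → j ≤ L → s j ≤ s n := by
    intro j hj hjL
    rcases hmem with h | h
    · have := h.2.2 j (Finset.mem_Icc.mpr (by omega))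
      rw [hadd _ j h.1 (by omega) hjL] at this
      linarith
    · rw [Set.mem_singleton_iff] at h; omega
  -- For any maximizer m of s, m + 1 is admissible in the definition of ℓ⋆, so n ≤ m. Since s_n
  -- dominates everything to its right, s_m ≤ s_n.
  have hmax : ∀ j ∈ Finset.Icc 1 L, s j ≤ s n := by
    obtain ⟨m, hm, hmm⟩ := Finset.exists_max_image (Finset.Icc 1 L) s ⟨1, by simpa using hL⟩
    rw [Finset.mem_Icc] at hm
    have hmS : m + 1 ∈ S := by
      by_cases h : m = L
      · exact Or.inr (by simp [h])
      · refine Or.inl ⟨by omega, by omega, fun j hj => ?_⟩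
        rw [Finset.mem_Icc] at hj
        rw [hadd _ j (by omega) hj.1 hj.2]
        have := hmm j (Finset.mem_Icc.mpr (by omega))
        simpa using this
    have hnm : n ≤ m := by have := hle _ hmS; omega
    have hmn : s m ≤ s n := by
      rcases hnm.eq_or_lt with h | h
      · rw [h]
      · exact hright m h hm.2
    exact fun j hj => (hmm j hj).trans hmn
  have hlim := tendsto_log_sum (Finset.Icc 1 L)
    (fun j k => ∏ i ∈ Finset.Icc 2 j, xStat ρ Λ q k i) s
    (fun j hj k => Finset.prod_pos fun i hi => hx k i (by
      simp only [Finset.mem_Icc] at hi hj ⊢; omega))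
    (fun j hj => (hsj j hj).congr fun k => by
      rw [Real.log_prod fun i hi => (hx k i (by
        simp only [Finset.mem_Icc] at hi hj ⊢; omega)).ne'])
    n hnmem hmax
  have hfin := hlim.sub (hsj n hnmem)
  rw [sub_self] at hfin
  refine hfin.congr fun k => ?_
  rw [slopeGap, ← prod_one_add_eta hL (hx k),
    Real.log_prod fun i hi => (one_add_eta_pos (hx k) hi).ne']

/-! ### Signs of ζ and α, and the growth rate of α. -/

theorem wgt_nonneg {m ℓ : ℕ} (hρ : ∀ i < ℓ - 1, 0 ≤ ρ i) : 0 ≤ wgt ρ m ℓ :=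
  Finset.prod_nonneg fun j hj => hρ j (Finset.mem_Ico.mp hj).2

/-- The subtracted term is the top summand p = ℓ - 1 of B, which `hn` keeps in the range; what
remains is a sum of nonnegative terms. -/
theorem Cco_nonneg {m n ℓ : ℕ} (hn : n ≤ ℓ) (hℓ : 1 ≤ ℓ) (hρ : ∀ i < ℓ, ρ i ≤ 1)
    (hΛ : ∀ j ∈ Finset.Icc 1 (ℓ - 1), 0 ≤ Λ m j) : 0 ≤ Cco ρ Λ m n ℓ := by
  obtain ⟨ℓ, rfl⟩ : ∃ i, ℓ = i + 1 := ⟨ℓ - 1, by omega⟩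
  rw [Cco, Bco, Finset.sum_Ico_succ_top (by omega), add_tsub_cancel_right, add_sub_cancel_right]
  refine Finset.sum_nonneg fun p hp => mul_nonneg ?_ (Finset.prod_nonneg fun j hj => hΛ j ?_)
  · have := hρ p (by simp at hp; omega)
    linarith
  · simp only [Finset.mem_Icc, Finset.mem_Ico] at hj hp ⊢; omega

theorem zeta_nonneg {m ℓ : ℕ} (hℓ : 1 ≤ ℓ) (hρ0 : ∀ i < ℓ, 0 ≤ ρ i) (hρ : ∀ i < ℓ, ρ i ≤ 1)
    (hΛ : ∀ j ∈ Finset.Icc 1 (ℓ - 1), 0 ≤ Λ (m + 1) j) (hq : ∀ j, 0 ≤ q m j) :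
    0 ≤ zeta ρ Λ q m ℓ := by
  have hw : ∀ j, 0 ≤ wgt ρ j ℓ := fun j => wgt_nonneg fun i hi => hρ0 i (by omega)
  have h1 := hρ (ℓ - 1) (by omega)
  refine mul_nonneg (one_div_nonneg.mpr (mul_nonneg (by linarith) (Finset.prod_nonneg hΛ)))
    (div_nonneg (Finset.sum_nonneg fun j hj => ?_) (Finset.sum_nonneg fun j _ => ?_))
  · have := (Finset.mem_Icc.mp hj).2
    exact mul_nonneg (mul_nonneg (hq j) (hw j)) (Cco_nonneg (by omega) hℓ hρ hΛ)
  · exact mul_nonneg (hq j) (hw j)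

/-- This is the factor of α independent of k. The last parameter is only bounded above, since it is
ρ_{L,L+1} = 0 when ℓ = L + 1. -/
theorem alpha_factor_pos {ℓ : ℕ} (hℓ : 1 ≤ ℓ) (hρ : ∀ i < ℓ - 1, 0 < ρ i ∧ ρ i < 1)
    (h0 : ρ 0 < 1) (hlast : ρ (ℓ - 1) < 1) :
    0 < (∏ j ∈ Finset.Icc 1 (ℓ - 2), ρ j) * ∑ j ∈ Finset.range ℓ, (1 - ρ j) / (1 - ρ 0) := by
  refine mul_pos (Finset.prod_pos fun j hj => (hρ j ?_).1) (Finset.sum_pos (fun j hj => ?_) ?_)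
  · rw [Finset.mem_Icc] at hj; omega
  · refine div_pos (sub_pos.mpr ?_) (by linarith)
    rw [Finset.mem_range] at hj
    rcases (show j ≤ ℓ - 1 by omega).eq_or_lt with rfl | h
    · exact hlast
    · exact (hρ j h).2
  · exact ⟨0, by simp; omega⟩

theorem alpha_pos {k ℓ : ℕ} (hℓ : 1 ≤ ℓ) (hρ : ∀ i < ℓ - 1, 0 < ρ i ∧ ρ i < 1)
    (h0 : ρ 0 < 1) (hlast : ρ (ℓ - 1) < 1) : 0 < alpha ρ k ℓ := by
  rw [alpha, mul_assoc]
  exact mul_pos (pow_pos (div_pos (by linarith) (by linarith)) _) (alpha_factor_pos hℓ hρ h0 hlast)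

theorem tendsto_avg_log_alpha {ℓ : ℕ} (hℓ : 1 ≤ ℓ) (hρ : ∀ i < ℓ - 1, 0 < ρ i ∧ ρ i < 1)
    (h0 : ρ 0 < 1) (hlast : ρ (ℓ - 1) < 1) :
    Tendsto (fun k : ℕ => 1 / (k : ℝ) * Real.log (alpha ρ k ℓ)) atTop
      (𝓝 (Real.log ((1 - ρ (ℓ - 1)) / (1 - ρ 0)))) := by
  have hr : 0 < (1 - ρ (ℓ - 1)) / (1 - ρ 0) := div_pos (by linarith) (by linarith)
  have hc := alpha_factor_pos hℓ hρ h0 hlast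
  have h := (tendsto_const_nhds (x := Real.log ((1 - ρ (ℓ - 1)) / (1 - ρ 0))) (f := atTop)).add
    (tendsto_avg_const (Real.log
      ((∏ j ∈ Finset.Icc 1 (ℓ - 2), ρ j) * ∑ j ∈ Finset.range ℓ, (1 - ρ j) / (1 - ρ 0))))
  rw [add_zero] at h
  refine h.congr' ?_
  filter_upwards [eventually_gt_atTop 0] with k hk
  rw [alpha, mul_assoc, Real.log_mul (pow_pos hr k).ne' hc.ne', Real.log_pow]
  have : (k : ℝ) ≠ 0 := by positivity
  field_simp

end Deterministic

/-! ### Growth rates of the products of the x_ℓ. -/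

section Growth

variable {ρ : ℕ → ℝ} {Λ q : ℕ → ℕ → ℝ} {L : ℕ}

theorem one_add_zeta_pos (hρ : ∀ ℓ, ℓ < L → 0 < ρ ℓ ∧ ρ ℓ < 1) (hρL : ρ L = 0)
    (hΛ : ∀ m j, 1 ≤ m → j ∈ Finset.Icc 1 L → 0 < Λ m j) (hq : ∀ m j, 0 ≤ q m j)
    (m : ℕ) {ℓ : ℕ} (h1 : 1 ≤ ℓ) (hℓ : ℓ ≤ L + 1) : 0 < 1 + zeta ρ Λ q m ℓ := by
  have hcase : ∀ i < ℓ, i < L ∨ i = L := fun i hi => by omega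
  have := zeta_nonneg (ρ := ρ) (Λ := Λ) (q := q) (m := m) h1
    (fun i hi => by
      rcases hcase i hi with h | rfl
      · exact (hρ i h).1.le
      · exact hρL.ge)
    (fun i hi => by
      rcases hcase i hi with h | rfl
      · exact (hρ i h).2.le
      · rw [hρL]; exact zero_le_one)
    (fun j hj => (hΛ (m + 1) j (by omega) (by simp only [Finset.mem_Icc] at hj ⊢; omega)).le)
    (hq m)
  linarith

theorem rho_lt_one (hρ : ∀ ℓ, ℓ < L → 0 < ρ ℓ ∧ ρ ℓ < 1) (hρL : ρ L = 0)
    {i : ℕ} (hi : i ≤ L) : ρ i < 1 := by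
  rcases hi.eq_or_lt with rfl | h
  · rw [hρL]; exact zero_lt_one
  · exact (hρ i h).2

theorem Jprod_pos (hρ : ∀ ℓ, ℓ < L → 0 < ρ ℓ ∧ ρ ℓ < 1) (hρL : ρ L = 0)
    (hΛ : ∀ m j, 1 ≤ m → j ∈ Finset.Icc 1 L → 0 < Λ m j) (hq : ∀ m j, 0 ≤ q m j)
    (k : ℕ) {ℓ : ℕ} (h1 : 1 ≤ ℓ) (hℓ : ℓ ≤ L + 1) : 0 < Jprod ρ Λ q k ℓ :=
  Finset.prod_pos fun m _ => one_add_zeta_pos hρ hρL hΛ hq m h1 hℓ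

theorem alpha_pos' (hρ : ∀ ℓ, ℓ < L → 0 < ρ ℓ ∧ ρ ℓ < 1) (hρL : ρ L = 0)
    (k : ℕ) {ℓ : ℕ} (h1 : 1 ≤ ℓ) (hℓ : ℓ ≤ L + 1) : 0 < alpha ρ k ℓ :=
  alpha_pos h1 (fun i hi => hρ i (by omega)) (rho_lt_one hρ hρL (Nat.zero_le _))
    (rho_lt_one hρ hρL (by omega))

theorem xStat_pos (hρ : ∀ ℓ, ℓ < L → 0 < ρ ℓ ∧ ρ ℓ < 1) (hρL : ρ L = 0)
    (hΛ : ∀ m j, 1 ≤ m → j ∈ Finset.Icc 1 L → 0 < Λ m j) (hq : ∀ m j, 0 ≤ q m j)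
    (k : ℕ) {ℓ : ℕ} (hℓ : ℓ ∈ Finset.Icc 2 L) : 0 < xStat ρ Λ q k ℓ := by
  rw [Finset.mem_Icc] at hℓ
  refine mul_pos (mul_pos (div_pos ?_ ?_) (Finset.prod_pos fun m hm => ?_)) (div_pos ?_ ?_)
  · exact alpha_pos' hρ hρL k (by omega) (by omega)
  · exact alpha_pos' hρ hρL k (by omega) (by omega)
  · exact hΛ m ℓ (Finset.mem_Icc.mp hm).1 (Finset.mem_Icc.mpr (by omega))
  · exact Jprod_pos hρ hρL hΛ hq k (by omega) (by omega)
  · exact Jprod_pos hρ hρL hΛ hq k (by omega) (by omega)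

theorem log_xStat (hρ : ∀ ℓ, ℓ < L → 0 < ρ ℓ ∧ ρ ℓ < 1) (hρL : ρ L = 0)
    (hΛ : ∀ m j, 1 ≤ m → j ∈ Finset.Icc 1 L → 0 < Λ m j) (hq : ∀ m j, 0 ≤ q m j)
    (k : ℕ) {ℓ : ℕ} (hℓ : ℓ ∈ Finset.Icc 2 L) :
    Real.log (xStat ρ Λ q k ℓ) =
      (Real.log (alpha ρ k (ℓ + 1)) + Real.log (Jprod ρ Λ q k (ℓ + 1)) -
        (Real.log (alpha ρ k ℓ) + Real.log (Jprod ρ Λ q k ℓ))) +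
      ∑ m ∈ Finset.Icc 1 k, Real.log (Λ m ℓ) := by
  rw [Finset.mem_Icc] at hℓ
  have hα := alpha_pos' hρ hρL k (ℓ := ℓ) (by omega) (by omega)
  have hα' := alpha_pos' hρ hρL k (ℓ := ℓ + 1) (by omega) (by omega)
  have hJ := Jprod_pos hρ hρL hΛ hq k (ℓ := ℓ) (by omega) (by omega)
  have hJ' := Jprod_pos hρ hρL hΛ hq k (ℓ := ℓ + 1) (by omega) (by omega)
  have hC : ∀ m ∈ Finset.Icc 1 k, 0 < Λ m ℓ := fun m hm =>
    hΛ m ℓ (Finset.mem_Icc.mp hm).1 (Finset.mem_Icc.mpr (by omega))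
  rw [xStat, beta, Real.log_mul (mul_pos (div_pos hα' hα) (Finset.prod_pos hC)).ne'
      (div_pos hJ' hJ).ne', Real.log_mul (div_pos hα' hα).ne' (Finset.prod_pos hC).ne',
    Real.log_div hα'.ne' hα.ne', Real.log_div hJ'.ne' hJ.ne',
    Real.log_prod fun m hm => (hC m hm).ne']
  ring

/-- The growth rate of `x_ℓ ⋯ x_j` is `Δ_{ℓ,j}`. -/
theorem tendsto_avg_log_xStat {D : ℝ} {γ : ℕ → ℕ → ℝ}
    (hρ : ∀ ℓ, ℓ < L → 0 < ρ ℓ ∧ ρ ℓ < 1) (hρL : ρ L = 0)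
    (hΛ : ∀ m j, 1 ≤ m → j ∈ Finset.Icc 1 L → 0 < Λ m j) (hq : ∀ m j, 0 ≤ q m j)
    (hD : ∀ ℓ ∈ Finset.Icc 1 L, Tendsto
      (fun k : ℕ => 1 / (k : ℝ) * ∑ m ∈ Finset.Icc 1 k, Real.log (Λ m ℓ)) atTop (𝓝 D))
    {ℓ j : ℕ} (hℓ : 2 ≤ ℓ) (hj : ℓ ≤ j) (hjL : j ≤ L)
    (hγ : Tendsto (fun k : ℕ => 1 / (k : ℝ) * ∑ m ∈ Finset.Icc 1 k,
      Real.log ((1 + zeta ρ Λ q m (j + 1)) / (1 + zeta ρ Λ q m ℓ))) atTop (𝓝 (γ ℓ j))) :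
    Tendsto (fun k : ℕ => 1 / (k : ℝ) * ∑ i ∈ Finset.Icc ℓ j, Real.log (xStat ρ Λ q k i))
      atTop (𝓝 (Delta ρ D γ ℓ j)) := by
  have h0 := rho_lt_one hρ hρL (Nat.zero_le L)
  have hj1 := rho_lt_one hρ hρL hjL
  have hℓ1 := rho_lt_one hρ hρL (i := ℓ - 1) (by omega)
  have hα' := tendsto_avg_log_alpha (ℓ := j + 1) (by omega) (fun i hi => hρ i (by omega)) h0 hj1
  have hα := tendsto_avg_log_alpha (ℓ := ℓ) (by omega) (fun i hi => hρ i (by omega)) h0 hℓ1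
  have hC := tendsto_finsetSum (Finset.Icc ℓ j)
    (fun i hi => hD i (by simp only [Finset.mem_Icc] at hi ⊢; omega))
  have hlim := ((hα'.sub hα).add hC).add (tendsto_avg_range_pred hγ)
  have hval : Real.log ((1 - ρ (j + 1 - 1)) / (1 - ρ 0)) -
      Real.log ((1 - ρ (ℓ - 1)) / (1 - ρ 0)) + ∑ _i ∈ Finset.Icc ℓ j, D + γ ℓ j =
      Delta ρ D γ ℓ j := by
    rw [Delta, Real.log_div (by simpa using (sub_pos.mpr hj1).ne') (sub_pos.mpr h0).ne',
      Real.log_div (sub_pos.mpr hℓ1).ne' (sub_pos.mpr h0).ne',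
      Real.log_div (sub_pos.mpr hj1).ne' (sub_pos.mpr hℓ1).ne', Finset.sum_const, Nat.card_Icc,
      nsmul_eq_mul, Nat.cast_sub (by omega), add_tsub_cancel_right]
    push_cast
    ring
  rw [hval] at hlim
  refine hlim.congr fun k => ?_
  rw [← mul_sub, ← Finset.mul_sum, ← mul_add, ← mul_add]
  congr 1
  rw [Finset.sum_congr rfl fun i hi => log_xStat hρ hρL hΛ hq k (ℓ := i)
    (by simp only [Finset.mem_Icc] at hi ⊢; omega), Finset.sum_add_distrib]
  have hIcc : Finset.Icc ℓ j = Finset.Ico ℓ (j + 1) := by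
    ext; simp only [Finset.mem_Icc, Finset.mem_Ico]; omega
  -- Only the end indices j + 1 and ℓ of log α + log J survive, matching the shape of γ_{ℓ,j}.
  have htel := Finset.sum_Ico_sub
    (fun i => Real.log (alpha ρ k i) + Real.log (Jprod ρ Λ q k i)) (show ℓ ≤ j + 1 by omega)
  have hJ : ∑ m ∈ Finset.range (k - 1),
      Real.log ((1 + zeta ρ Λ q m (j + 1)) / (1 + zeta ρ Λ q m ℓ)) =
      Real.log (Jprod ρ Λ q k (j + 1)) - Real.log (Jprod ρ Λ q k ℓ) := by
    have hz : ∀ i, 1 ≤ i → i ≤ L + 1 → ∀ m, 1 + zeta ρ Λ q m i ≠ 0 := fun i h1 h2 m =>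
      (one_add_zeta_pos hρ hρL hΛ hq m h1 h2).ne'
    rw [Jprod, Jprod, Real.log_prod fun m _ => hz (j + 1) (by omega) (by omega) m,
      Real.log_prod fun m _ => hz ℓ (by omega) (by omega) m, ← Finset.sum_sub_distrib]
    exact Finset.sum_congr rfl fun m _ =>
      Real.log_div (hz (j + 1) (by omega) (by omega) m) (hz ℓ (by omega) (by omega) m)
  rw [hJ, hIcc, htel]
  ring

end Growth

/-! ### Divergence of the stopping times. -/

/-- A threshold above the finitely many values of the statistic before time n excludes stopping
before n. Nonemptiness is essential, as `sInf ∅ = 0`. -/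
theorem tendsto_nu {L : ℕ} {q : ℕ → ℕ → ℝ} (h : ∀ A, (stopTimes L q A).Nonempty) :
    Tendsto (fun A : ℝ => nu L q A) atTop atTop := by
  refine tendsto_atTop.mpr fun n => ?_
  filter_upwards [(Filter.eventually_all_finset (Finset.range n)).mpr fun k _ =>
    eventually_gt_atTop (Real.log (∑ ℓ ∈ Finset.Icc 2 (L + 1), q k ℓ))] with A hA
  by_contra! hlt
  have hmem : nu L q A ∈ stopTimes L q A := Nat.sInf_mem (h A)
  exact absurd (hA _ (Finset.mem_range.mpr hlt)) (not_lt.mpr hmem)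

end ChangeProcess

/-! ### Absolute continuity of product measures and of densities. -/

theorem MeasureTheory.Measure.AbsolutelyContinuous.tprod {ι : Type*} {X : ι → Type*}
    [∀ i, MeasurableSpace (X i)] {μ ν : ∀ i, Measure (X i)} [∀ i, SigmaFinite (μ i)]
    [∀ i, SigmaFinite (ν i)] (h : ∀ i, μ i ≪ ν i) (l : List ι) :
    Measure.tprod l μ ≪ Measure.tprod l ν := by
  induction l with
  | nil => exact Measure.AbsolutelyContinuous.rfl
  | cons i l ih =>
    rw [Measure.tprod_cons, Measure.tprod_cons]
    exact (h i).prod ih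

theorem MeasureTheory.Measure.AbsolutelyContinuous.pi {ι : Type*} [Fintype ι] {X : ι → Type*}
    [∀ i, MeasurableSpace (X i)] {μ ν : ∀ i, Measure (X i)} [∀ i, SigmaFinite (μ i)]
    [∀ i, SigmaFinite (ν i)] (h : ∀ i, μ i ≪ ν i) :
    Measure.pi μ ≪ Measure.pi ν := by
  classical
  let _ : Encodable ι := Fintype.toEncodable ι
  rw [← Measure.pi'_eq_pi, ← Measure.pi'_eq_pi]
  exact (Measure.AbsolutelyContinuous.tprod h _).map (measurable_tProd_elim' _)

namespace ChangeProcess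

theorem absolutelyContinuous_withDensity_ofReal {E : Type*} [MeasurableSpace E] {ref : Measure E}
    {f g : E → ℝ} (hf : Measurable f) (hg : Measurable g) (hg0 : ∀ x, 0 ≤ g x)
    (h : ∀ᵐ x ∂ref, g x = 0 → f x = 0) :
    ref.withDensity (fun x => ENNReal.ofReal (f x)) ≪
      ref.withDensity (fun x => ENNReal.ofReal (g x)) := by
  refine Measure.AbsolutelyContinuous.mk fun s hs hs0 => ?_
  rw [withDensity_apply_eq_zero' hf.ennreal_ofReal.aemeasurable]
  rw [withDensity_apply_eq_zero' hg.ennreal_ofReal.aemeasurable] at hs0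
  refine measure_mono_null_ae ?_ hs0
  filter_upwards [h] with x hx hxs
  refine ⟨fun h0 => hxs.1 ?_, hxs.2⟩
  rw [hx (le_antisymm (ENNReal.ofReal_eq_zero.mp h0) (hg0 x)), ENNReal.ofReal_zero]

/-! ### Almost sure properties of the observations. -/

section Model

variable {E : Type*} [MeasurableSpace E] {ref : Measure E} {f₀ f₁ : E → ℝ}
  {L : ℕ} {ρ : ℕ → ℝ} {Ω : Type*} [MeasurableSpace Ω] {P : Measure Ω}
  {Γ : ℕ → Ω → ℕ} {Z : ℕ → ℕ → Ω → E}

theorem measurableSet_changeEvent (hm : IsModel L ρ ref f₀ f₁ P Γ Z) (g : ℕ → ℕ) :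
    MeasurableSet (changeEvent L Γ g) := by
  have : changeEvent L Γ g = ⋂ ℓ ∈ Finset.Icc 1 L, Γ ℓ ⁻¹' {g ℓ} := by
    ext; simp [changeEvent]
  rw [this]
  exact Finset.measurableSet_biInter _ fun ℓ _ =>
    hm.measurable_change ℓ (measurableSet_singleton _)

theorem info_le (hm : IsModel L ρ ref f₀ f₁ P Γ Z) (k : ℕ) :
    info L Z k ≤ (inferInstance : MeasurableSpace Ω) :=
  Measurable.comap_le (measurable_pi_lambda _ fun _ => hm.measurable_obs _ _)

theorem measurableSet_frontEvent (hm : IsModel L ρ ref f₀ f₁ P Γ Z) (k ℓ : ℕ) :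
    MeasurableSet (frontEvent L Γ k ℓ) := by
  have : frontEvent L Γ k ℓ = (⋂ j ∈ Finset.Icc 1 (ℓ - 1), Γ j ⁻¹' Set.Iic k) ∩
      ⋂ j ∈ Finset.Icc ℓ L, Γ j ⁻¹' Set.Ioi k := by
    ext; simp [frontEvent]
  rw [this]
  exact (Finset.measurableSet_biInter _ fun ℓ _ => hm.measurable_change ℓ measurableSet_Iic).inter
    (Finset.measurableSet_biInter _ fun ℓ _ => hm.measurable_change ℓ measurableSet_Ioi)

theorem ae_post_nonneg : ∀ᵐ ω ∂P, ∀ k ℓ, 0 ≤ post L P Γ Z k ℓ ω := by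
  simp only [ae_all_iff]
  exact fun k ℓ => condExp_nonneg (ae_of_all _ fun ω =>
    Set.indicator_nonneg (fun _ _ => zero_le_one) ω)

theorem ae_pos_withDensity {f g : E → ℝ} (hf : IsDensity ref f) (hg : IsDensity ref g)
    (h : ∀ᵐ x ∂ref, g x = 0 → f x = 0) :
    ∀ᵐ x ∂ref.withDensity (fun x => ENNReal.ofReal (f x)), 0 < g x := by
  rw [ae_withDensity_iff hf.measurable.ennreal_ofReal]
  filter_upwards [h] with x hx hfx
  refine (hg.nonneg x).lt_of_ne fun h0 => hfx ?_
  rw [hx h0.symm, ENNReal.ofReal_zero]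

variable [IsProbabilityMeasure P]

/-- To prove an almost sure property it is enough to prove it given the change-points. -/
theorem ae_of_forall_ae_cond (hm : IsModel L ρ ref f₀ f₁ P Γ Z) {p : Ω → Prop}
    (h : ∀ g : ℕ → ℕ, P (changeEvent L Γ g) ≠ 0 → ∀ᵐ ω ∂P[|changeEvent L Γ g], p ω) :
    ∀ᵐ ω ∂P, p ω := by
  -- There are uncountably many g, but the event sees only L coordinates; finite vectors form a
  -- countable family, so null sets can be united.
  let G : (Fin L → ℕ) → ℕ → ℕ := fun v ℓ => if h : ℓ - 1 < L then v ⟨ℓ - 1, h⟩ else 0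
  have hv : ∀ᵐ ω ∂P, ∀ v : Fin L → ℕ, ω ∈ changeEvent L Γ (G v) → p ω := by
    rw [ae_all_iff]
    intro v
    by_cases h0 : P (changeEvent L Γ (G v)) = 0
    · filter_upwards [measure_eq_zero_iff_ae_notMem.mp h0] with ω hω hω'
      exact absurd hω' hω
    · have := h (G v) h0
      rw [ProbabilityTheory.cond, Measure.ae_ennreal_smul_measure_iff (by simp),
        ae_restrict_iff' (measurableSet_changeEvent hm _)] at this
      exact this
  filter_upwards [hv] with ω hω
  refine hω (fun i => Γ (i + 1) ω) fun ℓ hℓ => ?_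
  rw [Finset.mem_Icc] at hℓ
  simp only [G]
  rw [dif_pos (by omega), Nat.sub_add_cancel hℓ.1]

theorem ae_lik_pos (hf₀ : IsDensity ref f₀) (hf₁ : IsDensity ref f₁)
    (hac : ∀ᵐ x ∂ref, f₁ x = 0 → f₀ x = 0) (hKL : FiniteKL ref f₁ f₀)
    (hm : IsModel L ρ ref f₀ f₁ P Γ Z) :
    ∀ᵐ ω ∂P, ∀ m j, 1 ≤ m → j ∈ Finset.Icc 1 L → 0 < lik f₀ f₁ Z ω m j := by
  refine ae_of_forall_ae_cond hm fun g hg => ?_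
  simp only [ae_all_iff]
  intro m j hm1 hj
  have hpos : ∀ᵐ x ∂Measure.map (Z m j) P[|changeEvent L Γ g], 0 < f₁ x / f₀ x := by
    rw [hm.obs_law g hg m hm1 j hj]
    by_cases hk : m < g j
    · simp only [hk, if_true]
      filter_upwards [ae_pos_withDensity hf₀ hf₁ hac, ae_pos_withDensity hf₀ hf₀ (by simp)]
        with x h1 h0 using div_pos h1 h0
    · simp only [hk, if_false]
      filter_upwards [ae_pos_withDensity hf₁ hf₁ (by simp), ae_pos_withDensity hf₁ hf₀ hKL.absCont]
        with x h1 h0 using div_pos h1 h0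
  exact ae_of_ae_map (hm.measurable_obs m j).aemeasurable hpos

/-- The strong law of large numbers for the log-likelihood ratios of a sensor. -/
theorem ae_tendsto_avg_log_lik (hf₀ : IsDensity ref f₀) (hf₁ : IsDensity ref f₁)
    (hKL : FiniteKL ref f₁ f₀) (hm : IsModel L ρ ref f₀ f₁ P Γ Z) :
    ∀ᵐ ω ∂P, ∀ ℓ ∈ Finset.Icc 1 L, Tendsto
      (fun k : ℕ => 1 / (k : ℝ) * ∑ m ∈ Finset.Icc 1 k, Real.log (lik f₀ f₁ Z ω m ℓ))
      atTop (𝓝 (klD ref f₁ f₀)) := by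
  refine ae_of_forall_ae_cond hm fun g hg => ?_
  simp only [ae_all_iff]
  intro ℓ hℓ
  have hℓ' := Finset.mem_Icc.mp hℓ
  have hprob : IsProbabilityMeasure P[|changeEvent L Γ g] := cond_isProbabilityMeasure hg
  set φ : E → ℝ := fun x => Real.log (f₁ x / f₀ x) with hφ
  have hφm : Measurable φ := (hf₁.measurable.div hf₀.measurable).log
  -- Dropping the first g ℓ observations leaves an i.i.d. sequence of density f₁.
  set Y : ℕ → Ω → E := fun n => Z (n + g ℓ + 1) ℓ with hY
  have hYm : ∀ n, Measurable (Y n) := fun n => hm.measurable_obs _ _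
  have hlaw : ∀ n, Measure.map (Y n) P[|changeEvent L Γ g] =
      ref.withDensity (fun x => ENNReal.ofReal (f₁ x)) := by
    intro n
    rw [hY, hm.obs_law g hg _ (by omega) ℓ hℓ]
    simp only [show ¬ (n + g ℓ + 1 < g ℓ) by omega, if_false]
  have htoReal : ∀ x, (ENNReal.ofReal (f₁ x)).toReal • φ x = φ x * f₁ x := fun x => by
    rw [ENNReal.toReal_ofReal (hf₁.nonneg x), smul_eq_mul, mul_comm]
  have hfin : ∀ᵐ x ∂ref, ENNReal.ofReal (f₁ x) < ⊤ := ae_of_all _ fun x => ENNReal.ofReal_lt_top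
  have hint : Integrable (fun ω => φ (Y 0 ω)) P[|changeEvent L Γ g] := by
    refine (integrable_map_measure hφm.aestronglyMeasurable (hYm 0).aemeasurable).mp ?_
    rw [hlaw, integrable_withDensity_iff_integrable_smul' hf₁.measurable.ennreal_ofReal hfin]
    simpa only [htoReal] using hKL.integrable
  have hmean : ∫ ω, φ (Y 0 ω) ∂P[|changeEvent L Γ g] = klD ref f₁ f₀ := by
    rw [← integral_map (f := φ) (hYm 0).aemeasurable hφm.aestronglyMeasurable, hlaw,
      integral_withDensity_eq_integral_toReal_smul hf₁.measurable.ennreal_ofReal hfin]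
    simp only [htoReal]
    rfl
  have hslln := strong_law_ae_real (μ := P[|changeEvent L Γ g]) (fun n ω => φ (Y n ω)) hint
    (fun i j hij => by
      have hind := (hm.obs_indep g hg).indepFun
        (i := (i + g ℓ, (⟨ℓ - 1, by omega⟩ : Fin L)))
        (j := (j + g ℓ, (⟨ℓ - 1, by omega⟩ : Fin L)))
        (by simpa using hij)
      simp only [Nat.sub_add_cancel hℓ'.1] at hind
      exact hind.comp hφm hφm)
    (fun i => IdentDistrib.comp (u := φ)
      ⟨(hYm i).aemeasurable, (hYm 0).aemeasurable, by rw [hlaw, hlaw]⟩ hφm)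
  rw [hmean] at hslln
  filter_upwards [hslln] with ω hω
  exact tendsto_avg_Icc_of_shift (a := fun m => Real.log (lik f₀ f₁ Z ω m ℓ)) (g ℓ) hω

/-- The laws of the observations up to time `k` given different change-points are equivalent. -/
theorem map_obs_absolutelyContinuous (hf₀ : IsDensity ref f₀) (hf₁ : IsDensity ref f₁)
    (hac : ∀ᵐ x ∂ref, f₁ x = 0 → f₀ x = 0) (hKL : FiniteKL ref f₁ f₀)
    (hm : IsModel L ρ ref f₀ f₁ P Γ Z) (k : ℕ) (g g' : ℕ → ℕ)
    (hg : P (changeEvent L Γ g) ≠ 0) (hg' : P (changeEvent L Γ g') ≠ 0) :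
    Measure.map (fun (ω : Ω) (i : Fin k × Fin L) => Z ((i.1 : ℕ) + 1) ((i.2 : ℕ) + 1) ω)
      P[|changeEvent L Γ g] ≪
    Measure.map (fun (ω : Ω) (i : Fin k × Fin L) => Z ((i.1 : ℕ) + 1) ((i.2 : ℕ) + 1) ω)
      P[|changeEvent L Γ g'] := by
  have hprod : ∀ h : ℕ → ℕ, P (changeEvent L Γ h) ≠ 0 →
      Measure.map (fun (ω : Ω) (i : Fin k × Fin L) => Z ((i.1 : ℕ) + 1) ((i.2 : ℕ) + 1) ω)
        P[|changeEvent L Γ h] =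
      Measure.pi fun i : Fin k × Fin L =>
        Measure.map (Z ((i.1 : ℕ) + 1) ((i.2 : ℕ) + 1)) P[|changeEvent L Γ h] := by
    intro h hh
    have hprob : IsProbabilityMeasure P[|changeEvent L Γ h] := cond_isProbabilityMeasure hh
    have hinj : Function.Injective fun i : Fin k × Fin L => ((i.1 : ℕ), i.2) := by
      rintro ⟨a, b⟩ ⟨c, d⟩ hcd
      simpa [Prod.ext_iff, Fin.ext_iff] using hcd
    exact (iIndepFun_iff_map_fun_eq_pi_map fun i => (hm.measurable_obs _ _).aemeasurable).mp
      ((hm.obs_indep h hh).precomp hinj)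
  have hprob : IsProbabilityMeasure P[|changeEvent L Γ g] := cond_isProbabilityMeasure hg
  have hprob' : IsProbabilityMeasure P[|changeEvent L Γ g'] := cond_isProbabilityMeasure hg'
  rw [hprod g hg, hprod g' hg']
  refine Measure.AbsolutelyContinuous.pi fun i => ?_
  have hmem : (i.2 : ℕ) + 1 ∈ Finset.Icc 1 L := Finset.mem_Icc.mpr (by omega)
  rw [hm.obs_law g hg _ (by omega) _ hmem, hm.obs_law g' hg' _ (by omega) _ hmem]
  by_cases h1 : (i.1 : ℕ) + 1 < g ((i.2 : ℕ) + 1) <;>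
    by_cases h2 : (i.1 : ℕ) + 1 < g' ((i.2 : ℕ) + 1) <;> simp only [h1, h2, if_true, if_false]
  · exact Measure.AbsolutelyContinuous.rfl
  · exact absolutelyContinuous_withDensity_ofReal hf₀.measurable hf₁.measurable hf₁.nonneg hac
  · exact absolutelyContinuous_withDensity_ofReal hf₁.measurable hf₀.measurable hf₀.nonneg
      hKL.absCont
  · exact Measure.AbsolutelyContinuous.rfl

/-! ### Posterior probabilities and finiteness of ν_A. -/

/-- The set B where positivity fails meets {no change by time k} in a null set, hence is null given
one particular configuration. As B depends only on the observations up to k, whose laws are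
equivalent for all configurations, B is null given each of them. -/
theorem ae_post_one_pos (hf₀ : IsDensity ref f₀) (hf₁ : IsDensity ref f₁)
    (hac : ∀ᵐ x ∂ref, f₁ x = 0 → f₀ x = 0) (hKL : FiniteKL ref f₁ f₀)
    (hρ : ∀ ℓ, ℓ < L → 0 < ρ ℓ ∧ ρ ℓ < 1)
    (hm : IsModel L ρ ref f₀ f₁ P Γ Z) :
    ∀ᵐ ω ∂P, ∀ k, 0 < post L P Γ Z k 1 ω := by
  rw [ae_all_iff]
  intro k
  set B : Set Ω := {ω | post L P Γ Z k 1 ω ≤ 0} with hB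
  have hBm : MeasurableSet[info L Z k] B :=
    (stronglyMeasurable_condExp (f := (frontEvent L Γ k 1).indicator fun _ => (1 : ℝ))
      (m := info L Z k) (μ := P)).measurable measurableSet_Iic
  have hle := info_le hm k
  have hF := measurableSet_frontEvent hm k 1
  have hint : Integrable ((frontEvent L Γ k 1).indicator fun _ => (1 : ℝ)) P :=
    (integrable_const 1).indicator hF
  have hBF : P (frontEvent L Γ k 1 ∩ B) = 0 := by
    have h1 : ∫ ω in B, post L P Γ Z k 1 ω ∂P ≤ 0 :=
      setIntegral_nonpos (hle _ hBm) fun ω hω => hω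
    rw [post, setIntegral_condExp hle hint hBm, integral_indicator_const _ hF,
      measureReal_restrict_apply hF, smul_eq_mul, mul_one] at h1
    exact (measureReal_eq_zero_iff).mp (le_antisymm h1 measureReal_nonneg)
  -- All sensors change together at k + 1: zero delays have positive probability. The value 0 at
  -- index 0 is what `change_law` requires.
  set g₀ : ℕ → ℕ := fun ℓ => if ℓ = 0 then 0 else k + 1 with hg₀
  have hg₀ne : P (changeEvent L Γ g₀) ≠ 0 := by
    rw [hm.change_law g₀ (by simp [hg₀]), ← pos_iff_ne_zero, ENNReal.ofReal_pos]
    refine Finset.prod_pos fun ℓ hℓ => ?_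
    rw [Finset.mem_Icc] at hℓ
    have hr := hρ (ℓ - 1) (by omega)
    rw [geomTrans, if_pos]
    · exact mul_pos hr.1 (pow_pos (by linarith) _)
    · simp only [hg₀]; split_ifs <;> omega
  have hsub : changeEvent L Γ g₀ ∩ B ⊆ frontEvent L Γ k 1 ∩ B := by
    refine Set.inter_subset_inter_left _ fun ω hω => ⟨by simp, fun j hj => ?_⟩
    have := hω j hj
    rw [this]
    rw [Finset.mem_Icc] at hj
    simp only [hg₀]
    rw [if_neg (by omega)]
    omega
  have hcond₀ : P[|changeEvent L Γ g₀] B = 0 := by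
    rw [cond_apply (measurableSet_changeEvent hm g₀), measure_mono_null hsub hBF, mul_zero]
  obtain ⟨S, hS, hSB⟩ := hBm
  have hVm : Measurable fun (ω : Ω) (i : Fin k × Fin L) =>
      Z ((i.1 : ℕ) + 1) ((i.2 : ℕ) + 1) ω :=
    measurable_pi_lambda _ fun _ => hm.measurable_obs _ _
  have hall : ∀ᵐ ω ∂P, ω ∉ B := by
    refine ae_of_forall_ae_cond hm fun g hg => ?_
    rw [← measure_eq_zero_iff_ae_notMem]
    have h := map_obs_absolutelyContinuous hf₀ hf₁ hac hKL hm k g g₀ hg hg₀ne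
      (s := S) (by rw [Measure.map_apply hVm hS, hSB, hcond₀])
    rwa [Measure.map_apply hVm hS, hSB] at h
  filter_upwards [hall] with ω hω
  exact not_le.mp hω

theorem tendsto_measure_compl_frontEvent (hm : IsModel L ρ ref f₀ f₁ P Γ Z) :
    Tendsto (fun k => P (frontEvent L Γ k (L + 1))ᶜ) atTop (𝓝 0) := by
  have hinter : ⋂ k, (frontEvent L Γ k (L + 1))ᶜ = ∅ := by
    rw [← Set.compl_iUnion, Set.compl_empty_iff, Set.eq_univ_iff_forall]
    intro ω
    rw [Set.mem_iUnion]
    -- The sum bounds every change-point, all being finite.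
    refine ⟨∑ j ∈ Finset.Icc 1 L, Γ j ω, fun j hj => ?_, by simp⟩
    exact Finset.single_le_sum (f := fun j => Γ j ω) (fun _ _ => Nat.zero_le _) (by simpa using hj)
  rw [← measure_empty (μ := P), ← hinter]
  refine tendsto_measure_iInter_atTop
    (fun k => (measurableSet_frontEvent hm k _).compl.nullMeasurableSet) ?_
    ⟨0, measure_ne_top _ _⟩
  intro a b hab
  refine Set.compl_subset_compl.mpr fun ω hω => ⟨fun j hj => (hω.1 j hj).trans hab, by simp⟩

/-- Conditional expectation contracts L¹, so the posterior probability that some sensor is unchanged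
tends to 0 in L¹, hence almost surely along a subsequence. It dominates p_{k,1} and equals 1 -
p_{k,L+1}. -/
theorem ae_exists_post_gt (hL : 1 ≤ L) (hm : IsModel L ρ ref f₀ f₁ P Γ Z) :
    ∀ᵐ ω ∂P, ∀ ε > 0, ∃ k, post L P Γ Z k 1 ω < ε ∧ 1 - ε < post L P Γ Z k (L + 1) ω := by
  set c : ℕ → Ω → ℝ := fun k =>
    P[(frontEvent L Γ k (L + 1))ᶜ.indicator (fun _ => (1 : ℝ)) | info L Z k] with hc
  have hint : ∀ s : Set Ω, MeasurableSet s → Integrable (s.indicator fun _ => (1 : ℝ)) P :=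
    fun s hs => (integrable_const 1).indicator hs
  have hF := fun k ℓ => measurableSet_frontEvent hm k ℓ
  have hadd : ∀ᵐ ω ∂P, ∀ k, c k ω + post L P Γ Z k (L + 1) ω = 1 := by
    rw [ae_all_iff]
    intro k
    have h1 := condExp_add (hint _ (hF k (L + 1)).compl) (hint _ (hF k (L + 1))) (info L Z k)
    rw [Set.indicator_compl_add_self, condExp_const (info_le hm k)] at h1
    filter_upwards [h1] with ω hω using hω.symm
  have hone : ∀ᵐ ω ∂P, ∀ k, post L P Γ Z k 1 ω ≤ c k ω := by
    rw [ae_all_iff]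
    intro k
    refine condExp_mono (hint _ (hF k 1)) (hint _ (hF k (L + 1)).compl) (ae_of_all _ ?_)
    refine Set.indicator_le_indicator_of_subset (fun ω hω hω' => ?_) fun _ => zero_le_one
    have h1 := hω.2 1 (by simp [hL])
    have h2 := hω'.1 1 (by simp [hL])
    omega
  have hnorm : Tendsto (fun k => eLpNorm (c k - 0) 1 P) atTop (𝓝 0) := by
    refine tendsto_of_tendsto_of_tendsto_of_le_of_le tendsto_const_nhds
      (tendsto_measure_compl_frontEvent hm) (fun _ => zero_le) fun k => ?_
    dsimp only
    rw [sub_zero]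
    refine (eLpNorm_condExp_le_eLpNorm _ le_rfl).trans_eq ?_
    rw [eLpNorm_indicator_const (hF k _).compl one_ne_zero ENNReal.one_ne_top]
    simp
  obtain ⟨ns, -, hns⟩ := (tendstoInMeasure_of_tendsto_eLpNorm one_ne_zero
    (fun k => integrable_condExp.aestronglyMeasurable) aestronglyMeasurable_zero
    hnorm).exists_seq_tendsto_ae
  filter_upwards [hadd, hone, hns] with ω h1 h2 h3 ε hε
  obtain ⟨i, hi⟩ := (h3.eventually_lt_const hε).exists
  exact ⟨ns i, (h2 _).trans_lt hi, by linarith [h1 (ns i)]⟩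

theorem ae_stopTimes_nonempty (hf₀ : IsDensity ref f₀) (hf₁ : IsDensity ref f₁)
    (hac : ∀ᵐ x ∂ref, f₁ x = 0 → f₀ x = 0) (hKL : FiniteKL ref f₁ f₀)
    (hL : 1 ≤ L) (hρ : ∀ ℓ, ℓ < L → 0 < ρ ℓ ∧ ρ ℓ < 1)
    (hm : IsModel L ρ ref f₀ f₁ P Γ Z) :
    ∀ᵐ ω ∂P, ∀ A : ℝ, (stopTimes L (qStat L ρ P Γ Z ω) A).Nonempty := by
  filter_upwards [ae_post_one_pos hf₀ hf₁ hac hKL hρ hm, ae_exists_post_gt hL hm,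
    ae_post_nonneg (L := L) (P := P) (Γ := Γ) (Z := Z)] with ω hpos hex hnn A
  -- Then p_{k,L+1} > 1/2 and p_{k,1} < e^{-A}/2, so q_{k,L+1} alone exceeds e^A because ρ_{0,1} <
  -- 1.
  obtain ⟨k, hk1, hk2⟩ := hex (min (1 / 2) (Real.exp (-A) / 2)) (by positivity)
  refine ⟨k, ?_⟩
  have hρ0 := hρ 0 (by omega)
  have hp := hpos k
  have hexp := Real.exp_pos A
  have h1 : post L P Γ Z k 1 ω < Real.exp (-A) / 2 := hk1.trans_le (min_le_right _ _)
  have h2 : 1 / 2 < post L P Γ Z k (L + 1) ω := by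
    have := min_le_left (1 / 2 : ℝ) (Real.exp (-A) / 2)
    linarith
  have hq : Real.exp A ≤ qStat L ρ P Γ Z ω k (L + 1) := by
    rw [qStat, le_div_iff₀ (mul_pos hρ0.1 hp)]
    have h3 : Real.exp A * post L P Γ Z k 1 ω ≤ 1 / 2 := by
      have := mul_le_mul_of_nonneg_left h1.le hexp.le
      rwa [← mul_div_assoc, ← Real.exp_add, add_neg_cancel, Real.exp_zero] at this
    have h4 : 0 ≤ Real.exp A * post L P Γ Z k 1 ω := by positivity
    nlinarith [mul_le_mul_of_nonneg_left hρ0.2.le h4]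
  have hsum : Real.exp A ≤ ∑ ℓ ∈ Finset.Icc 2 (L + 1), qStat L ρ P Γ Z ω k ℓ :=
    hq.trans (Finset.single_le_sum (f := fun ℓ => qStat L ρ P Γ Z ω k ℓ)
      (fun ℓ _ => div_nonneg (hnn k ℓ) (mul_pos hρ0.1 hp).le)
      (Finset.mem_Icc.mpr ⟨by omega, le_rfl⟩))
  exact (Real.le_log_iff_exp_le (hexp.trans_le hsum)).mpr hsum

end Model

end ChangeProcess

/-! ### The proposition. -/

theorem mainTheorem6
    {E : Type*} [MeasurableSpace E] (ref : Measure E) [SigmaFinite ref] (f₀ f₁ : E → ℝ)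
    (hf₀ : ChangeProcess.IsDensity ref f₀) (hf₁ : ChangeProcess.IsDensity ref f₁)
    (hac : ∀ᵐ x ∂ref, f₁ x = 0 → f₀ x = 0)
    (hKL : ChangeProcess.FiniteKL ref f₁ f₀)
    (L : ℕ) (hL : 1 ≤ L) (ρ : ℕ → ℝ)
    (hρ : ∀ ℓ, ℓ < L → 0 < ρ ℓ ∧ ρ ℓ < 1) (hρL : ρ L = 0)
    {Ω : Type*} [MeasurableSpace Ω] (P : Measure Ω) [IsProbabilityMeasure P]
    (Γ : ℕ → Ω → ℕ) (Z : ℕ → ℕ → Ω → E)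
    (hmodel : ChangeProcess.IsModel L ρ ref f₀ f₁ P Γ Z)
    (γ : ℕ → ℕ → Ω → ℝ)
    (hγ : ∀ ℓ j, 2 ≤ ℓ → ℓ ≤ j → j ≤ L → ∀ᵐ ω ∂P,
      Tendsto
        (fun k : ℕ => 1 / (k : ℝ) * ∑ m ∈ Finset.Icc 1 k,
          Real.log
            ((1 + ChangeProcess.zeta ρ (ChangeProcess.lik f₀ f₁ Z ω)
                (ChangeProcess.qStat L ρ P Γ Z ω) m (j + 1)) /
              (1 + ChangeProcess.zeta ρ (ChangeProcess.lik f₀ f₁ Z ω)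
                (ChangeProcess.qStat L ρ P Γ Z ω) m ℓ)))
        atTop (𝓝 (γ ℓ j ω))) :
    ∀ᵐ ω ∂P,
      let Λ := ChangeProcess.lik f₀ f₁ Z ω
      let q := ChangeProcess.qStat L ρ P Γ Z ω
      let ls := ChangeProcess.ellStar L
        (ChangeProcess.Delta ρ (ChangeProcess.klD ref f₁ f₀) (fun ℓ j => γ ℓ j ω))
      -- the stopping times are finite and tend to infinity
      (∀ A : ℝ, (ChangeProcess.stopTimes L q A).Nonempty) ∧
      Tendsto (fun A : ℝ => ChangeProcess.nu L q A) atTop atTop ∧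
      -- the convergence at the times `ν_A`, and along all deterministic times
      Tendsto (fun A : ℝ => ChangeProcess.slopeGap L ρ Λ q ls (ChangeProcess.nu L q A))
        atTop (𝓝 0) ∧
      Tendsto (fun k : ℕ => ChangeProcess.slopeGap L ρ Λ q ls k) atTop (𝓝 0) := by
  have hγ' : ∀ᵐ ω ∂P, ∀ ℓ j, 2 ≤ ℓ → ℓ ≤ j → j ≤ L → Tendsto
      (fun k : ℕ => 1 / (k : ℝ) * ∑ m ∈ Finset.Icc 1 k,
        Real.log
          ((1 + ChangeProcess.zeta ρ (ChangeProcess.lik f₀ f₁ Z ω)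
              (ChangeProcess.qStat L ρ P Γ Z ω) m (j + 1)) /
            (1 + ChangeProcess.zeta ρ (ChangeProcess.lik f₀ f₁ Z ω)
              (ChangeProcess.qStat L ρ P Γ Z ω) m ℓ)))
      atTop (𝓝 (γ ℓ j ω)) := by
    simp only [ae_all_iff]
    exact hγ
  filter_upwards [hγ', ChangeProcess.ae_lik_pos hf₀ hf₁ hac hKL hmodel,
    ChangeProcess.ae_tendsto_avg_log_lik hf₀ hf₁ hKL hmodel,
    ChangeProcess.ae_post_nonneg (L := L) (P := P) (Γ := Γ) (Z := Z),
    ChangeProcess.ae_stopTimes_nonempty hf₀ hf₁ hac hKL hL hρ hmodel]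
    with ω hγω hΛ hD hpost hne Λ q ls
  have hq : ∀ m j, 0 ≤ q m j := fun m j =>
    div_nonneg (hpost m j) (mul_nonneg (hρ 0 (by omega)).1.le (hpost m 1))
  have hnu := ChangeProcess.tendsto_nu hne
  have hgap : Tendsto (fun k : ℕ => ChangeProcess.slopeGap L ρ Λ q ls k) atTop (𝓝 0) :=
    ChangeProcess.tendsto_slopeGap hL _
      (fun k ℓ hℓ => ChangeProcess.xStat_pos hρ hρL hΛ hq k hℓ)
      fun ℓ j hℓ hj hjL => ChangeProcess.tendsto_avg_log_xStat
        (γ := fun ℓ j => γ ℓ j ω) hρ hρL hΛ hq hD hℓ hj hjL (hγω ℓ j hℓ hj hjL)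
  exact ⟨hne, hnu, hgap.comp hnu, hgap⟩
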